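/- For an integer $n\ge 1$ and a real number $\lambda$, let $\mathcal F_{\lambda,n}$ be the family of all subsets of $\{1,\dots,n\}$ of size at most $\lambda n$. For a sequence of integers $(a_1,\dots,a_n)$ and $A\subseteq\{1,\dots,n\}$ put $S(A)=\sum_{i\in A}a_i$. The sequence is called sum-distinct if $S(A_1)\ne S(A_2)$ for all distinct $A_1,A_2\subseteq\{1,\dots,n\}$, and $\mathcal F_{\lambda,n}$-sum distinct if $S(A_1)\neq S(A_2)$ for all distinct $A_1,A_2\in\mathcal F_{\lambda,n}$. Given a sequence of integers $(\overline{c_1},\dots,\overline{c_{67}})$ and $m\ge 67$, define $$c_{i,m}=\begin{cases}2^{i-1}, & 1\le i\le m-67,\\ 2^{m-67}\,\overline{c_{i-(m-67)}}, & m-67<i\le m.\end{cases}$$ Proposition. For every real $\lambda<1/4$ there is an $N$, depending only on $\lambda$, such that for every sum-distinct sequence of integers $(\overline{c_1},\dots,\overline{c_{67}})$ and every $n\ge N$, the sequence $\Sigma=(a_1,\dots,a_n)$ defined by $$a_i=\begin{cases} c_{i,n-1}, & i=1,\dots,n-1,\\ \displaystyle\sum_{0\le j<\frac{n-68}{2}-1}2^{2j},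 & i=n,\end{cases}$$ is $\mathcal F_{\lambda,n}$-sum distinct. In particular, this holds for Lunnon's sequence, which is the case where $(\overline{c_1},\dots,\overline{c_{67}})$ is Lunnon's sum-distinct sequence of $67$ integers. -/

import Mathlib

/-- The family `F_{l,n}` of all subsets of `{1, …, n}` with at most `l * n` elements. -/
def smallSubsets (l : ℝ) (n : ℕ) : Set (Finset ℕ) :=
  {A | A ⊆ Finset.Icc 1 n ∧ (A.card : ℝ) ≤ l * n}

/-- The subset sum `S(A) = ∑_{i ∈ A} a_i`. -/
def subsetSum (a : ℕ → ℤ) (A : Finset ℕ) : ℤ := ∑ i ∈ A, a i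

/-- `(a_1, …, a_n)` is sum-distinct: distinct subsets of `{1, …, n}` have distinct sums. -/
def IsSumDistinct (n : ℕ) (a : ℕ → ℤ) : Prop :=
  ∀ A₁ A₂ : Finset ℕ, A₁ ⊆ Finset.Icc 1 n → A₂ ⊆ Finset.Icc 1 n → A₁ ≠ A₂ →
    subsetSum a A₁ ≠ subsetSum a A₂

/-- `(a_1, …, a_n)` is `F_{l,n}`-sum distinct: distinct members of `F_{l,n}` have distinct
sums. -/
def IsSmallSumDistinct (l : ℝ) (n : ℕ) (a : ℕ → ℤ) : Prop :=
  ∀ A₁ ∈ smallSubsets l n, ∀ A₂ ∈ smallSubsets l n, A₁ ≠ A₂ →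
    subsetSum a A₁ ≠ subsetSum a A₂

/-- The element `c_{i,m}` (for `1 ≤ i ≤ m`, `67 ≤ m`) of the Lunnon sequence of length `m`
built from the base block `(c_1, …, c_67)`: the powers `1, 2, …, 2 ^ (m - 68)`, followed by
`2 ^ (m - 67)` times the base block. -/
def lunnonSeq (c : ℕ → ℤ) (m i : ℕ) : ℤ :=
  if i ≤ m - 67 then 2 ^ (i - 1) else 2 ^ (m - 67) * c (i - (m - 67))

/-- The sum of `2 ^ (2 * j)` over the integers `0 ≤ j < (n - 68) / 2 - 1`; the bound is a
rational number, and every such `j` is below `n`. -/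
def insertedElement (n : ℕ) : ℤ :=
  ∑ j ∈ (Finset.range n).filter (fun j : ℕ => (j : ℚ) < ((n : ℚ) - 68) / 2 - 1), 2 ^ (2 * j)

/-- The sequence `(a_1, …, a_n)`: the Lunnon sequence of length `n - 1` with the inserted
element appended in position `n`. -/
def extendedLunnonSeq (c : ℕ → ℤ) (n i : ℕ) : ℤ :=
  if i = n then insertedElement n else lunnonSeq c (n - 1) i

/-!
Write `M = n - 68`. The sum of a subset of the extended sequence is
`ε * x + l + 2 ^ M * h`, where `ε` records whether the inserted element `x` is used, `l < 2 ^ M` is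
the number whose binary digits are given by the chosen powers of two, and `h` is a subset sum of
the base block (`subsetSum_extendedLunnonSeq`).

If two sets agree on the use of `x`, reduction modulo `2 ^ M` and the sum-distinctness of the base
block show that they are equal, whatever their sizes. Otherwise, since `x < 2 ^ M`, an equality of
sums says that `x + l₁ = l₂` or `x + l₁ = l₂ + 2 ^ M`. Now `x = 1 + 4 + ⋯ + 4 ^ (J - 1)` with
`J` about `n / 2` has the binary expansion `10101…01`, whose digit density `1/2` cannot be improved
even with signed digits: the numbers of binary ones of `l` and of `x + l` always add up to at least
`J` (`le_bitCount_add_bitCount`). So the two sets have at least `n / 2 - O(1)` elements together,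
which is impossible when each has at most `λ n` elements with `λ < 1/4` and `n` is large.
-/

/-! ### Numbers of binary ones -/

/-- The number of ones in the binary expansion of `k`. -/
def bitCount (k : ℕ) : ℕ := k.bitIndices.length

theorem bitCount_two_mul (k : ℕ) : bitCount (2 * k) = bitCount k := by
  simp [bitCount]

theorem bitCount_two_mul_add_one (k : ℕ) : bitCount (2 * k + 1) = bitCount k + 1 := by
  simp [bitCount]

theorem bitCount_sum_two_pow (s : Finset ℕ) : bitCount (∑ i ∈ s, 2 ^ i) = s.card := by
  rw [bitCount, ← List.toFinset_card_of_nodup, Finset.toFinset_bitIndices_sum_two_pow]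
  exact Nat.bitIndices_nodup

theorem bitCount_succ_le (k : ℕ) : bitCount (k + 1) ≤ bitCount k + 1 := by
  induction k using Nat.strong_induction_on with
  | _ k ih =>
    obtain ⟨q, rfl | rfl⟩ := Nat.even_or_odd' k
    · rw [bitCount_two_mul_add_one, bitCount_two_mul]
    · have := ih q (by omega)
      rw [show 2 * q + 1 + 1 = 2 * (q + 1) by ring, bitCount_two_mul, bitCount_two_mul_add_one]
      omega

/-- A difference representation of `1 + 4 + ⋯ + 4 ^ (J - 1)` needs at least `J` powers of two:
the expansion `10101…01` has no two adjacent nonzero digits and is therefore a signed binary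
expansion with the fewest nonzero digits. -/
theorem le_bitCount_add_bitCount (J l : ℕ) :
    J ≤ bitCount l + bitCount (∑ j ∈ Finset.range J, 2 ^ (2 * j) + l) := by
  induction J generalizing l with
  | zero => simp
  | succ J ih =>
    set x := ∑ j ∈ Finset.range J, 2 ^ (2 * j) with hx
    have hsucc : ∑ j ∈ Finset.range (J + 1), 2 ^ (2 * j) = 4 * x + 1 := by
      rw [Finset.sum_range_succ', hx, Finset.mul_sum]
      simp only [mul_add, pow_add]
      norm_num [mul_comm]
    rw [hsucc]
    -- The two lowest digits of `l` determine those of the sum.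
    obtain ⟨p, rfl | rfl⟩ := Nat.even_or_odd' l <;> obtain ⟨q, rfl | rfl⟩ := Nat.even_or_odd' p
    · have := ih q
      rw [show 4 * x + 1 + 2 * (2 * q) = 2 * (2 * (x + q)) + 1 by ring]
      simp only [bitCount_two_mul, bitCount_two_mul_add_one]
      omega
    · have := ih q
      rw [show 4 * x + 1 + 2 * (2 * q + 1) = 2 * (2 * (x + q) + 1) + 1 by ring]
      simp only [bitCount_two_mul, bitCount_two_mul_add_one]
      omega
    · have := ih q
      rw [show 4 * x + 1 + (2 * (2 * q) + 1) = 2 * (2 * (x + q) + 1) by ring]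
      simp only [bitCount_two_mul, bitCount_two_mul_add_one]
      omega
    -- With lowest digits `11` there is a carry into `q`, paid for by the two ones of `l`.
    · have := ih (q + 1)
      have := bitCount_succ_le q
      rw [show 4 * x + 1 + (2 * (2 * q + 1) + 1) = 2 * (2 * (x + (q + 1))) by ring]
      simp only [bitCount_two_mul, bitCount_two_mul_add_one]
      omega

/-! ### The inserted element -/

theorem insertedElement_eq {n : ℕ} (hn : 69 ≤ n) :
    insertedElement n = ((∑ j ∈ Finset.range ((n - 69) / 2), 2 ^ (2 * j) : ℕ) : ℤ) := by
  have : (Finset.range n).filter (fun j : ℕ => (j : ℚ) < ((n : ℚ) - 68) / 2 - 1) =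
      Finset.range ((n - 69) / 2) := by
    ext j
    have h : (j : ℚ) < ((n : ℚ) - 68) / 2 - 1 ↔ 2 * j + 70 < n := by
      rw [← Nat.cast_lt (α := ℚ)]
      push_cast
      constructor <;> intro <;> linarith
    simp only [Finset.mem_filter, Finset.mem_range, h]
    omega
  rw [insertedElement, this]
  push_cast
  rfl

theorem sum_range_two_pow_two_mul_lt (J : ℕ) :
    ∑ j ∈ Finset.range J, 2 ^ (2 * j) < 2 ^ (2 * J) := by
  induction J with
  | zero => simp
  | succ J ih =>
    rw [Finset.sum_range_succ, mul_add, pow_add]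
    omega

/-! ### Decomposition of subset sums -/

/-- The exponents of the powers of two among the terms with index in `A`: the term with index
`i ≤ M` is `2 ^ (i - 1)`. -/
def lowExponents (M : ℕ) (A : Finset ℕ) : Finset ℕ :=
  (A.filter (· ≤ M)).image (· - 1)

/-- The indices, within the base block, of the terms with index in `A`; the base block occupies
the indices `M + 1, …, M + 67`. -/
def blockIndices (M : ℕ) (A : Finset ℕ) : Finset ℕ :=
  (A.filter (fun i => M < i ∧ i ≤ M + 67)).image (· - M)

theorem card_lowExponents_le (M : ℕ) (A : Finset ℕ) : (lowExponents M A).card ≤ A.card :=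
  Finset.card_image_le.trans (Finset.card_filter_le _ _)

theorem card_lowExponents_lt {M k : ℕ} {A : Finset ℕ} (hk : k ∈ A) (hM : M < k) :
    (lowExponents M A).card < A.card :=
  Finset.card_image_le.trans_lt
    (Finset.card_lt_card (Finset.filter_ssubset.2 ⟨k, hk, by omega⟩))

theorem blockIndices_subset (M : ℕ) (A : Finset ℕ) : blockIndices M A ⊆ Finset.Icc 1 67 := by
  intro j
  simp only [blockIndices, Finset.mem_image, Finset.mem_filter, Finset.mem_Icc]
  rintro ⟨i, hi, rfl⟩
  omega

theorem lt_of_mem_lowExponents {M k : ℕ} {A : Finset ℕ} (hA : ∀ i ∈ A, 1 ≤ i)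
    (hk : k ∈ lowExponents M A) : k < M := by
  simp only [lowExponents, Finset.mem_image, Finset.mem_filter] at hk
  obtain ⟨i, hi, rfl⟩ := hk
  have := hA i hi.1
  omega

theorem sum_lowExponents_lt {M : ℕ} {A : Finset ℕ} (hA : ∀ i ∈ A, 1 ≤ i) :
    ∑ k ∈ lowExponents M A, 2 ^ k < 2 ^ M :=
  Nat.geomSum_lt le_rfl fun _ hk => lt_of_mem_lowExponents hA hk

theorem mem_iff_of_parts_eq {n : ℕ} {A B : Finset ℕ} (hn : 68 ≤ n)
    (hA : A ⊆ Finset.Icc 1 n) (hB : B ⊆ Finset.Icc 1 n)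
    (hlow : lowExponents (n - 68) A = lowExponents (n - 68) B)
    (hblock : blockIndices (n - 68) A = blockIndices (n - 68) B)
    (hlast : n ∈ A → n ∈ B) {i : ℕ} (hi : i ∈ A) : i ∈ B := by
  have hin := Finset.mem_Icc.1 (hA hi)
  rcases eq_or_ne i n with rfl | hne
  · exact hlast hi
  by_cases hiM : i ≤ n - 68
  · have : i - 1 ∈ lowExponents (n - 68) B :=
      hlow ▸ Finset.mem_image_of_mem _ (Finset.mem_filter.2 ⟨hi, hiM⟩)
    simp only [lowExponents, Finset.mem_image, Finset.mem_filter] at this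
    obtain ⟨k, ⟨hk, -⟩, hki⟩ := this
    have := Finset.mem_Icc.1 (hB hk)
    rwa [show i = k by omega]
  · have : i - (n - 68) ∈ blockIndices (n - 68) B :=
      hblock ▸ Finset.mem_image_of_mem _ (Finset.mem_filter.2 ⟨hi, by omega⟩)
    simp only [blockIndices, Finset.mem_image, Finset.mem_filter] at this
    obtain ⟨k, ⟨hk, hk'⟩, hki⟩ := this
    rwa [show i = k by omega]

theorem subsetSum_extendedLunnonSeq (c : ℕ → ℤ) {n : ℕ} (hn : 68 ≤ n) {A : Finset ℕ}
    (hA : A ⊆ Finset.Icc 1 n) :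
    subsetSum (extendedLunnonSeq c n) A =
      (if n ∈ A then insertedElement n else 0) +
        ((∑ k ∈ lowExponents (n - 68) A, 2 ^ k : ℕ) : ℤ) +
          2 ^ (n - 68) * subsetSum c (blockIndices (n - 68) A) := by
  have hterm : ∀ i ∈ A, extendedLunnonSeq c n i =
      (if i = n then insertedElement n else 0) + (if i ≤ n - 68 then 2 ^ (i - 1) else 0) +
        (if n - 68 < i ∧ i ≤ n - 68 + 67 then 2 ^ (n - 68) * c (i - (n - 68)) else 0) := by
    intro i hi
    have hin := Finset.mem_Icc.1 (hA hi)
    rw [extendedLunnonSeq, lunnonSeq, show n - 1 - 67 = n - 68 by omega]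
    rcases eq_or_ne i n with rfl | hne
    · rw [if_pos rfl, if_pos rfl, if_neg (by omega), if_neg (by omega), add_zero, add_zero]
    · by_cases hiM : i ≤ n - 68
      · rw [if_neg hne, if_pos hiM, if_neg hne, if_pos hiM, if_neg (by omega)]
        ring
      · rw [if_neg hne, if_neg hiM, if_neg hne, if_neg hiM, if_pos (by omega)]
        ring
  have hlow : ((∑ k ∈ lowExponents (n - 68) A, 2 ^ k : ℕ) : ℤ) =
      ∑ i ∈ A, if i ≤ n - 68 then 2 ^ (i - 1) else 0 := by
    rw [lowExponents, Finset.sum_image, ← Finset.sum_filter]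
    · push_cast
      rfl
    · intro i hi j hj hij
      have := Finset.mem_Icc.1 (hA (Finset.mem_filter.1 hi).1)
      have := Finset.mem_Icc.1 (hA (Finset.mem_filter.1 hj).1)
      simp only at hij
      omega
  have hblock : 2 ^ (n - 68) * subsetSum c (blockIndices (n - 68) A) =
      ∑ i ∈ A, if n - 68 < i ∧ i ≤ n - 68 + 67 then 2 ^ (n - 68) * c (i - (n - 68)) else 0 := by
    rw [subsetSum, blockIndices, Finset.sum_image, ← Finset.sum_filter, Finset.mul_sum]
    intro i hi j hj hij
    have := (Finset.mem_filter.1 hi).2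
    have := (Finset.mem_filter.1 hj).2
    simp only at hij
    omega
  rw [subsetSum, Finset.sum_congr rfl hterm, Finset.sum_add_distrib, Finset.sum_add_distrib,
    Finset.sum_ite_eq', hlow, hblock]

/-! ### Comparing two subset sums -/

/-- Two sets that agree on the use of the inserted element are distinguished by their sums,
without any restriction on their sizes. -/
theorem eq_of_subsetSum_eq_of_mem_iff {c : ℕ → ℤ} (hc : IsSumDistinct 67 c) {n : ℕ} (hn : 68 ≤ n)
    {A B : Finset ℕ} (hA : A ⊆ Finset.Icc 1 n) (hB : B ⊆ Finset.Icc 1 n) (hlast : n ∈ A ↔ n ∈ B)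
    (h : subsetSum (extendedLunnonSeq c n) A = subsetSum (extendedLunnonSeq c n) B) : A = B := by
  rw [subsetSum_extendedLunnonSeq c hn hA, subsetSum_extendedLunnonSeq c hn hB] at h
  have hlA := sum_lowExponents_lt (M := n - 68) fun i hi => (Finset.mem_Icc.1 (hA hi)).1
  have hlB := sum_lowExponents_lt (M := n - 68) fun i hi => (Finset.mem_Icc.1 (hB hi)).1
  simp only [hlast, add_assoc, add_right_inj] at h
  set lA := ∑ k ∈ lowExponents (n - 68) A, 2 ^ k
  set lB := ∑ k ∈ lowExponents (n - 68) B, 2 ^ k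
  have hl : lA = lB := by
    have := congrArg (· % (2 ^ (n - 68) : ℤ)) h
    simp only [Int.add_mul_emod_self_left] at this
    have hmod : lA % 2 ^ (n - 68) = lB % 2 ^ (n - 68) := by exact_mod_cast this
    rwa [Nat.mod_eq_of_lt hlA, Nat.mod_eq_of_lt hlB] at hmod
  have hblock : blockIndices (n - 68) A = blockIndices (n - 68) B := by
    by_contra hne
    refine hc _ _ (blockIndices_subset _ _) (blockIndices_subset _ _) hne ?_
    rw [hl, add_right_inj] at h
    exact mul_left_cancel₀ (by positivity) h
  have hlow : lowExponents (n - 68) A = lowExponents (n - 68) B :=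
    Finset.geomSum_injective le_rfl hl
  ext i
  exact ⟨mem_iff_of_parts_eq hn hA hB hlow hblock hlast.1,
    mem_iff_of_parts_eq hn hB hA hlow.symm hblock.symm hlast.2⟩

/-- Two sets with equal sums of which only the first uses the inserted element are large. -/
theorem le_card_add_card_of_subsetSum_eq {c : ℕ → ℤ} {n : ℕ} (hn : 69 ≤ n)
    {A B : Finset ℕ} (hA : A ⊆ Finset.Icc 1 n) (hB : B ⊆ Finset.Icc 1 n)
    (hnA : n ∈ A) (hnB : n ∉ B)
    (h : subsetSum (extendedLunnonSeq c n) A = subsetSum (extendedLunnonSeq c n) B) :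
    (n - 69) / 2 ≤ A.card + B.card := by
  rw [subsetSum_extendedLunnonSeq c (by omega) hA, subsetSum_extendedLunnonSeq c (by omega) hB,
    if_pos hnA, if_neg hnB, zero_add, insertedElement_eq hn] at h
  have hB1 : ∀ i ∈ B, 1 ≤ i := fun i hi => (Finset.mem_Icc.1 (hB hi)).1
  have hlA := sum_lowExponents_lt (M := n - 68) fun i hi => (Finset.mem_Icc.1 (hA hi)).1
  have hlB := sum_lowExponents_lt (M := n - 68) hB1
  have hcA := card_lowExponents_lt (M := n - 68) hnA (by omega)
  have hcB := card_lowExponents_le (n - 68) B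
  have hx : ∑ j ∈ Finset.range ((n - 69) / 2), 2 ^ (2 * j) < 2 ^ (n - 68) :=
    (sum_range_two_pow_two_mul_lt _).trans_le (Nat.pow_le_pow_right two_pos (by omega))
  have hw := le_bitCount_add_bitCount ((n - 69) / 2) (∑ k ∈ lowExponents (n - 68) A, 2 ^ k)
  rw [bitCount_sum_two_pow] at hw
  set x := ∑ j ∈ Finset.range ((n - 69) / 2), 2 ^ (2 * j)
  set lA := ∑ k ∈ lowExponents (n - 68) A, 2 ^ k
  set lB := ∑ k ∈ lowExponents (n - 68) B, 2 ^ k with hlB_def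
  set d := subsetSum c (blockIndices (n - 68) B) - subsetSum c (blockIndices (n - 68) A) with hd
  have hxd : (x : ℤ) + lA = lB + 2 ^ (n - 68) * d := by rw [hd]; linarith
  have hpos : (0 : ℤ) < 2 ^ (n - 68) := by positivity
  zify at hlA hlB hx
  have hd0 : -1 < d := by
    refine lt_of_mul_lt_mul_left (a := (2 : ℤ) ^ (n - 68)) ?_ hpos.le
    linarith [Int.natCast_nonneg x, Int.natCast_nonneg lA]
  have hd2 : d < 2 := by
    refine lt_of_mul_lt_mul_left (a := (2 : ℤ) ^ (n - 68)) ?_ hpos.le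
    linarith [Int.natCast_nonneg lB]
  obtain hd | hd : d = 0 ∨ d = 1 := by omega
  · have hxl : x + lA = lB := by
      zify
      rw [hxd, hd]
      ring
    rw [hxl, hlB_def, bitCount_sum_two_pow] at hw
    omega
  · -- The extra `2 ^ M` is one more binary one; it is absorbed by the index `n` of `A`.
    have hM : n - 68 ∉ lowExponents (n - 68) B :=
      fun hmem => (lt_of_mem_lowExponents hB1 hmem).false
    have hxl : x + lA = ∑ k ∈ insert (n - 68) (lowExponents (n - 68) B), 2 ^ k := by
      rw [Finset.sum_insert hM, ← hlB_def]
      zify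
      rw [hxd, hd]
      ring
    rw [hxl, bitCount_sum_two_pow, Finset.card_insert_of_notMem hM] at hw
    omega

theorem mainTheorem5 (l : ℝ) (hl : l < 1 / 4) :
    ∃ N : ℕ, ∀ c : ℕ → ℤ, IsSumDistinct 67 c →
      ∀ n : ℕ, N ≤ n → IsSmallSumDistinct l n (extendedLunnonSeq c n) := by
  -- For `n` beyond this bound, `n / 2 - 35` exceeds `2 * l * n`.
  obtain ⟨N, hN⟩ := exists_nat_gt (35 / (1 / 2 - 2 * l))
  refine ⟨max N 69, fun c hc n hn A hA B hB hAB h => ?_⟩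
  have hn69 : 69 ≤ n := (le_max_right _ _).trans hn
  have hNn : (N : ℝ) ≤ n := by exact_mod_cast (le_max_left _ _).trans hn
  have hlarge : 35 < n * (1 / 2 - 2 * l) :=
    (div_lt_iff₀ (by linarith)).1 (hN.trans_le hNn)
  have hcard : ¬ (n - 69) / 2 ≤ A.card + B.card := by
    intro hle
    have hnat : n ≤ 2 * (A.card + B.card) + 70 := by omega
    have hreal : (n : ℝ) ≤ 2 * (A.card + B.card) + 70 := by exact_mod_cast hnat
    linarith [hA.2, hB.2]
  by_cases hnA : n ∈ A <;> by_cases hnB : n ∈ B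
  · exact hAB (eq_of_subsetSum_eq_of_mem_iff hc (by omega) hA.1 hB.1 (by tauto) h)
  · exact hcard (le_card_add_card_of_subsetSum_eq hn69 hA.1 hB.1 hnA hnB h)
  · exact hcard (add_comm A.card _ ▸
      le_card_add_card_of_subsetSum_eq hn69 hB.1 hA.1 hnB hnA h.symm)
  · exact hAB (eq_of_subsetSum_eq_of_mem_iff hc (by omega) hA.1 hB.1 (by tauto) h)
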